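/- Let $X$ be a Banach space, $X\neq\{0\}$, and let $C\subset X$ be a closed convex cone with $C\cap(-C)=\{0\}$ and interior $C_0$. Write $x\le y$ if $y-x\in C$; for $x\in X$, $y\in C_0$ put $M(x/y)=\inf\{t\in\mathbb R: x\le ty\}$, and for $x,y\in C_0$ let $d_T(x,y)=\log\max\{M(x/y),M(y/x)\}$ be Thompson's metric. Let $J=[0,T)$ with $T\le+\infty$, let $D\subset X$ be open, and let $\phi:J\times D\to X$ be continuous and Fréchet differentiable in the second variable, with derivative $D\phi_t(x)$ such that for every closed bounded set $K\subset X$ contained in $D$ one has $\sup_{t\in J,\,x\in K}\|D\phi_t(x)\|<\infty$. For $s\in J$ and $x_0\in D$ let $t\mapsto M_s^t(x_0)$, $t\in[s,a)$, be the maximal solution in $D$ of $\dot x(t)=\phi(t,x(t))$, $x(s)=x_0$, with $[s,a)\subset J$. For an open set $U\subset D$ and $x_0\in U$ let $t_U(s,x_0)=\sup\{b\in(s,a): M_s^t(x_0)\in U\ \text{for all } t\in[s,b)\}$. Let $U\subset D\cap C_0$ be open with $\lambda U\subset U$ for all $\lambda\in(0,1]$, and suppose that the flow is order-preserving on $U$: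 for all $x_1,x_2\in U$ with $x_1\ge x_2$, one has $M_s^t(x_1)\ge M_s^t(x_2)$ whenever $s\in J$ and $s\le t<\min\{t_U(s,x_1),t_U(s,x_2)\}$. Then the best (largest) constant $\alpha$ such that, for all $x_1,x_2\in U$, $$d_T(M_s^t(x_1),M_s^t(x_2))\le e^{-\alpha(t-s)}\,d_T(x_1,x_2)\qquad\text{for all } s\in J,\ s\le t<\min\{t_U(s,x_1),t_U(s,x_2)\},$$ is $$\alpha=-\sup_{s\in J,\ x\in U} M\big((D\phi_s(x)x-\phi(s,x))/x\big).$$ Here the supremum of the real constants $\alpha$ with this property, taken in $[-\infty,+\infty]$, equals the right-hand side and is attained when it is finite; the value $-\infty$ means that no real constant has the property. -/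

import Mathlib

namespace ThompsonFlow

noncomputable section

section Cone

variable {X : Type*} [NormedAddCommGroup X] [NormedSpace ℝ X]

/-- The order of the cone: `x ≤ y` iff `y - x ∈ C`. -/
def ConeLE (C : ProperCone ℝ X) (x y : X) : Prop := y - x ∈ C

/-- `M(x/y) = inf {t ∈ ℝ : x ≤ t y}`, meant for `y` in the interior of `C`. -/
def coneM (C : ProperCone ℝ X) (x y : X) : ℝ := sInf {t : ℝ | ConeLE C x (t • y)}

/-- Thompson's part metric on the interior of `C`. -/
def thompsonDist (C : ProperCone ℝ X) (x y : X) : ℝ :=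
  Real.log (max (coneM C x y) (coneM C y x))

end Cone

/-- The interval `[s, a)` of real numbers, where `a` may be `+∞`. -/
def halfOpen (s : ℝ) (a : EReal) : Set ℝ := {t : ℝ | s ≤ t ∧ (t : EReal) < a}

section Flow

variable {X : Type*} [NormedAddCommGroup X] [NormedSpace ℝ X]

/-- `x` solves `x' = φ(t, x)`, `x(s) = x₀` on `[s, a) ⊆ J = [0, T)`, with values in `D`
(the derivative at `s` is the right derivative). The derivative of a solution is continuous as
soon as `φ` is continuous on `J × D`. -/
structure IsSolution (T : EReal) (D : Set X) (φ : ℝ → X → X) (s : ℝ) (a : EReal) (x₀ : X)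
    (x : ℝ → X) : Prop where
  lt : (s : EReal) < a
  subset : halfOpen s a ⊆ halfOpen 0 T
  init : x s = x₀
  mem : ∀ t ∈ halfOpen s a, x t ∈ D
  deriv : ∀ t ∈ halfOpen s a, HasDerivWithinAt x (φ t (x t)) (halfOpen s a) t

/-- The right end `a` of the interval `[s, a)` of the maximal solution. -/
def lifetime (T : EReal) (D : Set X) (φ : ℝ → X → X) (s : ℝ) (x₀ : X) : EReal :=
  sSup {a : EReal | ∃ x : ℝ → X, IsSolution T D φ s a x₀ x}

open Classical in
/-- The flow `M_s^t(x₀)`: the value at `t` of the solution started from `x₀` at time `s`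
(and the dummy value `x₀` when no solution reaches `t`). -/
def flow (T : EReal) (D : Set X) (φ : ℝ → X → X) (s t : ℝ) (x₀ : X) : X :=
  if h : ∃ x : ℝ → X, ∃ a : EReal, (t : EReal) < a ∧ IsSolution T D φ s a x₀ x
  then h.choose t else x₀

/-- `t_U(s, x₀)`, the first time at which the trajectory leaves `U`. -/
def exitTime (T : EReal) (D : Set X) (φ : ℝ → X → X) (U : Set X) (s : ℝ) (x₀ : X) : EReal :=
  sSup {b : EReal | (s : EReal) < b ∧ b < lifetime T D φ s x₀ ∧
    ∀ t ∈ halfOpen s b, flow T D φ s t x₀ ∈ U}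

/-- The flow is order-preserving on `U`. -/
def OrderPreservingOn (C : ProperCone ℝ X) (T : EReal) (D : Set X) (φ : ℝ → X → X)
    (U : Set X) : Prop :=
  ∀ x₁ ∈ U, ∀ x₂ ∈ U, ConeLE C x₂ x₁ → ∀ s ∈ halfOpen 0 T, ∀ t : ℝ, s ≤ t →
    (t : EReal) < min (exitTime T D φ U s x₁) (exitTime T D φ U s x₂) →
    ConeLE C (flow T D φ s t x₂) (flow T D φ s t x₁)

/-- The flow contracts Thompson's metric on `U` at the rate `α`, which may have any sign. -/
def ContractsOn (C : ProperCone ℝ X) (T : EReal) (D : Set X) (φ : ℝ → X → X)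
    (U : Set X) (α : ℝ) : Prop :=
  ∀ x₁ ∈ U, ∀ x₂ ∈ U, ∀ s ∈ halfOpen 0 T, ∀ t : ℝ, s ≤ t →
    (t : EReal) < min (exitTime T D φ U s x₁) (exitTime T D φ U s x₂) →
    thompsonDist C (flow T D φ s t x₁) (flow T D φ s t x₂) ≤
      Real.exp (-α * (t - s)) * thompsonDist C x₁ x₂

end Flow

/-- `a` is the best (largest) real constant with the property `P`: the supremum of these
constants, attained when it is finite. `a = ⊥` means that no real constant has the property. -/
def IsBestConstant (P : ℝ → Prop) (a : EReal) : Prop :=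
  IsLUB ((fun α : ℝ => (α : EReal)) '' {α : ℝ | P α}) a ∧ ∀ r : ℝ, (r : EReal) = a → P r

end

end ThompsonFlow

open Set Filter Topology
open scoped Pointwise

namespace ThompsonFlow

/-! ### The cone order, the gauge `coneM` and Thompson's metric. -/

section Cone

variable {X : Type*} [NormedAddCommGroup X] [NormedSpace ℝ X] {C : ProperCone ℝ X}

/-! A rate α is admissible iff Dφ_s(x)x - φ(s,x) ≤ -αx for all s ∈ J, x ∈ U. By `coneM_le_iff` this
says M((Dφ_s(x)x - φ(s,x))/x) ≤ -α, so the best α is minus the supremum.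

Sufficiency. The derivative of u ↦ e^u φ(e^{-u}x) - αux is e^u(φ(p) - Dφ(p)p - αp) with p = e^{-u}x,
which lies in C; integrating gives φ(x) ≤ e^r φ(e^{-r}x) - αrx (`coneLE_exp_smul_of_fderiv`). Hence,
if z is a solution and ρ > 0 decays at a rate slightly smaller than α, then e^{-ρ}z is a strict
subsolution. It lies in U because U is stable under shrinking, and order preservation keeps it below
any solution w in U above it initially (`coneLE_of_strict_subsolution`). Letting the slack tend to 0
gives the estimate for z ≤ e^d w; exchanging z and w gives the one for the metric.

Necessity. Contraction applied to x and e^{-r}x, differentiated at t = s, gives back the integrated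
inequality; differentiating that at r = 0 gives the infinitesimal condition. -/

theorem ConeLE.trans {x y z : X} (hxy : ConeLE C x y) (hyz : ConeLE C y z) : ConeLE C x z := by
  have h : z - x = (y - x) + (z - y) := by abel
  rw [ConeLE, h]
  exact C.add_mem hxy hyz

theorem ConeLE.smul {x y : X} (h : ConeLE C x y) {r : ℝ} (hr : 0 ≤ r) :
    ConeLE C (r • x) (r • y) := by
  have := C.smul_mem h hr
  rwa [smul_sub] at this

theorem smul_mem_interior {x : X} (hx : x ∈ interior (C : Set X)) {r : ℝ} (hr : 0 < r) :
    r • x ∈ interior (C : Set X) := by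
  have h : r • interior (C : Set X) ⊆ interior (C : Set X) := by
    refine interior_maximal ?_ (isOpen_interior.smul₀ hr.ne')
    rintro _ ⟨y, hy, rfl⟩
    exact C.smul_mem (interior_subset hy) hr.le
  exact h (Set.smul_mem_smul_set hx)

theorem add_mem_interior {x y : X} (hx : x ∈ C) (hy : y ∈ interior (C : Set X)) :
    x + y ∈ interior (C : Set X) := by
  have h : (x + ·) '' interior (C : Set X) ⊆ interior (C : Set X) := by
    refine interior_maximal ?_ ((Homeomorph.addLeft x).isOpenMap _ isOpen_interior)
    rintro _ ⟨y, hy, rfl⟩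
    exact C.add_mem hx (interior_subset hy)
  exact h ⟨y, hy, rfl⟩

theorem exists_coneLE_smul {y : X} (hy : y ∈ interior (C : Set X)) (x : X) :
    ∃ t : ℝ, ConeLE C x (t • y) := by
  have h : Tendsto (fun e : ℝ => y - e • x) (𝓝[>] 0) (𝓝 y) := by
    have : Continuous fun e : ℝ => y - e • x := by fun_prop
    simpa using (this.tendsto 0).mono_left nhdsWithin_le_nhds
  obtain ⟨e, he, hpos⟩ :=
    ((h.eventually (mem_interior_iff_mem_nhds.1 hy)).and self_mem_nhdsWithin).exists
  have hpos : 0 < e := hpos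
  refine ⟨e⁻¹, ?_⟩
  have := C.smul_mem he (inv_nonneg.2 hpos.le)
  rwa [smul_sub, inv_smul_smul₀ hpos.ne'] at this

/-- A salient closed cone of a nontrivial space contains no opposite of an interior point. -/
theorem neg_notMem_of_mem_interior [Nontrivial X] (hC : ∀ x : X, x ∈ C → -x ∈ C → x = 0) {y : X}
    (hy : y ∈ interior (C : Set X)) : -y ∉ C := by
  intro hn
  obtain rfl : y = 0 := hC y (interior_subset hy) hn
  have hall : ∀ x : X, x ∈ C := fun x => by
    obtain ⟨t, ht⟩ := exists_coneLE_smul hy (-x)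
    simpa [ConeLE] using ht
  obtain ⟨x, hx⟩ := exists_ne (0 : X)
  exact hx (hC x (hall x) (hall _))

theorem nonneg_of_smul_mem [Nontrivial X] (hC : ∀ x : X, x ∈ C → -x ∈ C → x = 0) {y : X}
    (hy : y ∈ interior (C : Set X)) {t : ℝ} (h : t • y ∈ C) : 0 ≤ t := by
  by_contra! ht
  refine neg_notMem_of_mem_interior hC hy ?_
  have := C.smul_mem h (inv_nonneg.2 (neg_nonneg.2 ht.le))
  rwa [smul_smul, inv_neg, neg_mul, inv_mul_cancel₀ ht.ne, neg_one_smul] at this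

theorem bddBelow_coneLE_smul [Nontrivial X] (hC : ∀ x : X, x ∈ C → -x ∈ C → x = 0) {y : X}
    (hy : y ∈ interior (C : Set X)) (x : X) : BddBelow {t : ℝ | ConeLE C x (t • y)} := by
  -- If -x ≤ sy and x ≤ ty, adding gives (t + s)y ∈ C, which forces t ≥ -s.
  obtain ⟨s, hs⟩ := exists_coneLE_smul hy (-x)
  refine ⟨-s, fun t ht => ?_⟩
  have h : (t + s) • y ∈ C := by
    have h : (t + s) • y = (t • y - x) + (s • y - -x) := by rw [add_smul]; abel
    rw [h]
    exact C.add_mem ht hs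
  linarith [nonneg_of_smul_mem hC hy h]

theorem coneLE_coneM_smul [Nontrivial X] (hC : ∀ x : X, x ∈ C → -x ∈ C → x = 0) {y : X}
    (hy : y ∈ interior (C : Set X)) (x : X) : ConeLE C x (coneM C x y • y) := by
  have hcl : IsClosed {t : ℝ | ConeLE C x (t • y)} :=
    C.isClosed.preimage (f := fun t : ℝ => t • y - x) (by fun_prop)
  exact hcl.csInf_mem (exists_coneLE_smul hy x) (bddBelow_coneLE_smul hC hy x)

/-- The infimum is attained because C is closed, and the admissible t form an up-set because y ∈ C.
Every estimate on `coneM` thus becomes a cone inequality. -/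
theorem coneM_le_iff [Nontrivial X] (hC : ∀ x : X, x ∈ C → -x ∈ C → x = 0) {x y : X}
    (hy : y ∈ interior (C : Set X)) {t : ℝ} : coneM C x y ≤ t ↔ ConeLE C x (t • y) := by
  refine ⟨fun h => ?_, fun h => csInf_le (bddBelow_coneLE_smul hC hy x) h⟩
  refine (coneLE_coneM_smul hC hy x).trans ?_
  have := C.smul_mem (interior_subset hy) (sub_nonneg.2 h)
  rwa [sub_smul] at this

theorem coneM_pos [Nontrivial X] (hC : ∀ x : X, x ∈ C → -x ∈ C → x = 0) {x y : X}
    (hx : x ∈ interior (C : Set X)) (hy : y ∈ interior (C : Set X)) : 0 < coneM C x y := by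
  by_contra! h
  rw [coneM_le_iff hC hy] at h
  exact neg_notMem_of_mem_interior hC hx (by simpa [ConeLE] using h)

theorem thompsonDist_le_iff [Nontrivial X] (hC : ∀ x : X, x ∈ C → -x ∈ C → x = 0) {x y : X}
    (hx : x ∈ interior (C : Set X)) (hy : y ∈ interior (C : Set X)) {r : ℝ} :
    thompsonDist C x y ≤ r ↔ ConeLE C x (Real.exp r • y) ∧ ConeLE C y (Real.exp r • x) := by
  rw [thompsonDist, Real.log_le_iff_le_exp (lt_max_of_lt_left (coneM_pos hC hx hy)), max_le_iff,
    coneM_le_iff hC hy, coneM_le_iff hC hx]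

theorem thompsonDist_nonneg [Nontrivial X] (hC : ∀ x : X, x ∈ C → -x ∈ C → x = 0) {x y : X}
    (hx : x ∈ interior (C : Set X)) (hy : y ∈ interior (C : Set X)) : 0 ≤ thompsonDist C x y := by
  obtain ⟨h₁, h₂⟩ := (thompsonDist_le_iff hC hx hy).1 le_rfl
  set r := thompsonDist C x y
  -- From x ≤ e^r y ≤ e^{2r} x.
  have h : (Real.exp (r + r) - 1) • x ∈ C := by
    have := h₁.trans (h₂.smul (Real.exp_pos r).le)
    rwa [ConeLE, smul_smul, ← Real.exp_add, ← one_smul ℝ x, smul_smul, mul_one,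
      ← sub_smul] at this
  have := nonneg_of_smul_mem hC hx h
  have : 0 ≤ r + r := Real.one_le_exp_iff.1 (by linarith)
  linarith

/-- A curve whose derivative lies in the cone is nondecreasing for the order of the cone. -/
theorem coneLE_of_hasDerivAt_mem {f f' : ℝ → X} {a b : ℝ} (hab : a ≤ b)
    (hf : ∀ t ∈ Icc a b, HasDerivAt f (f' t) t) (hf' : ∀ t ∈ Icc a b, f' t ∈ C) :
    ConeLE C (f a) (f b) := by
  by_contra h
  -- The functional l is nonnegative on C but negative at f b - f a, although l ∘ f has nonnegative
  -- derivative.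
  obtain ⟨l, hl, hneg⟩ := C.hyperplane_separation_point h
  have hd : ∀ t ∈ Icc a b, HasDerivAt (fun t => l (f t)) (l (f' t)) t := fun t ht =>
    l.hasFDerivAt.comp_hasDerivAt t (hf t ht)
  have hmono : MonotoneOn (fun t => l (f t)) (Icc a b) := by
    refine monotoneOn_of_deriv_nonneg (convex_Icc a b)
      (fun t ht => (hd t ht).continuousAt.continuousWithinAt)
      (fun t ht => (hd t (interior_subset ht)).differentiableAt.differentiableWithinAt) ?_
    intro t ht
    rw [(hd t (interior_subset ht)).deriv]
    exact hl _ (hf' t (interior_subset ht))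
  have := hmono (left_mem_Icc.2 hab) (right_mem_Icc.2 hab) hab
  simp only [map_sub] at hneg
  linarith

end Cone

/-! ### Solutions, the flow and exit times. -/

section Flow

/-- A vector field on `[0, T) × D`, continuous, and differentiable in space with a derivative
bounded on the closed bounded subsets of `D`, uniformly in time. -/
structure IsRegularField {X : Type*} [NormedAddCommGroup X] [NormedSpace ℝ X] (T : EReal)
    (D : Set X) (φ : ℝ → X → X) : Prop where
  isOpen : IsOpen D
  continuousOn : ContinuousOn (fun p : ℝ × X => φ p.1 p.2) (halfOpen 0 T ×ˢ D)
  differentiableAt : ∀ t ∈ halfOpen 0 T, ∀ x ∈ D, DifferentiableAt ℝ (φ t) x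
  bound : ∀ K : Set X, K ⊆ D → IsClosed K → Bornology.IsBounded K →
    ∃ L : ℝ, ∀ t ∈ halfOpen 0 T, ∀ x ∈ K, ‖fderiv ℝ (φ t) x‖ ≤ L

variable {X : Type*} [NormedAddCommGroup X] [NormedSpace ℝ X]
  {T : EReal} {D U : Set X} {φ : ℝ → X → X} {s t : ℝ} {a b : EReal} {x₀ : X} {x y : ℝ → X}

theorem left_mem_halfOpen (h : (s : EReal) < a) : s ∈ halfOpen s a := ⟨le_rfl, h⟩

theorem halfOpen_mono (hst : s ≤ t) (hba : b ≤ a) : halfOpen t b ⊆ halfOpen s a :=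
  fun _ h => ⟨hst.trans h.1, h.2.trans_le hba⟩

theorem Icc_subset_halfOpen (h : (t : EReal) < a) : Icc s t ⊆ halfOpen s a :=
  fun _ hr => ⟨hr.1, (EReal.coe_le_coe_iff.2 hr.2).trans_lt h⟩

theorem halfOpen_mem_nhdsGE (h : t ∈ halfOpen s a) : halfOpen s a ∈ 𝓝[≥] t := by
  obtain ⟨r, htr, hra⟩ := EReal.lt_iff_exists_real_btwn.1 h.2
  exact mem_of_superset (Icc_mem_nhdsGE (EReal.coe_lt_coe_iff.1 htr))
    ((Icc_subset_halfOpen hra).trans (halfOpen_mono h.1 le_rfl))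

theorem IsSolution.hasDerivWithinAt_Ici (hx : IsSolution T D φ s a x₀ x) (ht : t ∈ halfOpen s a) :
    HasDerivWithinAt x (φ t (x t)) (Ici t) t :=
  (hx.deriv t ht).mono_of_mem_nhdsWithin (halfOpen_mem_nhdsGE ht)

theorem IsSolution.continuousOn (hx : IsSolution T D φ s a x₀ x) :
    ContinuousOn x (halfOpen s a) := fun t ht => (hx.deriv t ht).continuousWithinAt

theorem IsSolution.continuousOn_Icc (hx : IsSolution T D φ s a x₀ x) {r : ℝ} (hs : s ≤ r)
    (ht : (t : EReal) < a) : ContinuousOn x (Icc r t) :=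
  hx.continuousOn.mono ((Icc_subset_halfOpen ht).trans (halfOpen_mono hs le_rfl))

/-- A solution, restarted at a later time and stopped at an earlier one. -/
theorem IsSolution.restrict (hx : IsSolution T D φ s a x₀ x) (hst : s ≤ t) (htb : (t : EReal) < b)
    (hba : b ≤ a) : IsSolution T D φ t b (x t) x where
  lt := htb
  subset := (halfOpen_mono hst hba).trans hx.subset
  init := rfl
  mem r hr := hx.mem r (halfOpen_mono hst hba hr)
  deriv r hr := (hx.deriv r (halfOpen_mono hst hba hr)).mono (halfOpen_mono hst hba)

/-- A closed ball inside D is closed, bounded and convex, so the derivative bound and the mean value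
inequality give a Lipschitz constant uniform in time. -/
theorem exists_lipschitzOnWith_closedBall (hφ : IsRegularField T D φ) (hx₀ : x₀ ∈ D) :
    ∃ r > 0, Metric.closedBall x₀ r ⊆ D ∧ ∃ K : NNReal, ∀ t ∈ halfOpen 0 T,
      ∀ r' ≤ r, LipschitzOnWith K (φ t) (Metric.closedBall x₀ r') := by
  obtain ⟨r, hr, hrD⟩ := Metric.nhds_basis_closedBall.mem_iff.1 (hφ.isOpen.mem_nhds hx₀)
  obtain ⟨L, hL⟩ := hφ.bound _ hrD Metric.isClosed_closedBall Metric.isBounded_closedBall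
  refine ⟨r, hr, hrD, L.toNNReal, fun t ht r' hr' => ?_⟩
  refine LipschitzOnWith.mono ?_ (Metric.closedBall_subset_closedBall hr')
  refine (convex_closedBall x₀ r).lipschitzOnWith_of_nnnorm_fderiv_le
    (fun x hx => hφ.differentiableAt t ht x (hrD hx)) fun x hx => ?_
  exact NNReal.le_toNNReal_of_coe_le (hL t ht x hx)

/-- Uniqueness of the solution of a locally Lipschitz equation. -/
theorem IsSolution.eqOn (hφ : IsRegularField T D φ)
    (hx : IsSolution T D φ s a x₀ x) (hy : IsSolution T D φ s b x₀ y)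
    (hst : s ≤ t) (hta : (t : EReal) < a) (htb : (t : EReal) < b) : x t = y t := by
  have hcx := hx.continuousOn_Icc le_rfl hta
  have hcy := hy.continuousOn_Icc le_rfl htb
  have hcl : IsClosed ({r | x r = y r} ∩ Icc s t) := by
    have : {r | x r = y r} ∩ Icc s t = Icc s t ∩ (fun r => x r - y r) ⁻¹' {0} := by
      ext r; simp [sub_eq_zero, and_comm]
    rw [this]
    exact (hcx.sub hcy).preimage_isClosed_of_isClosed isClosed_Icc isClosed_singleton
  -- Continuous induction: the Lipschitz bound holds only near the current point, so agreement is
  -- extended a little past each r.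
  refine hcl.Icc_subset_of_forall_exists_gt (hx.init.trans hy.init.symm) ?_
    (right_mem_Icc.2 hst)
  rintro r ⟨hr, hsr, hrt⟩ q (hq : r < q)
  have hr : x r = y r := hr
  have hra : r ∈ halfOpen s a := Icc_subset_halfOpen hta ⟨hsr, hrt.le⟩
  have hrb : r ∈ halfOpen s b := Icc_subset_halfOpen htb ⟨hsr, hrt.le⟩
  obtain ⟨R, hR, -, K, hK⟩ := exists_lipschitzOnWith_closedBall hφ (hx.mem r hra)
  have hball := Metric.closedBall_mem_nhds (x r) hR
  have h₁ : ∀ᶠ p in 𝓝[≥] r, x p ∈ Metric.closedBall (x r) R :=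
    (hx.hasDerivWithinAt_Ici hra).continuousWithinAt hball
  have h₂ : ∀ᶠ p in 𝓝[≥] r, y p ∈ Metric.closedBall (x r) R :=
    (hy.hasDerivWithinAt_Ici hrb).continuousWithinAt (by rwa [← hr])
  obtain ⟨p, hp, hsub⟩ := mem_nhdsGE_iff_exists_Icc_subset.1 (h₁.and h₂)
  have hp : r < p := hp
  set m := min (min p q) t
  have hm : r < m := lt_min (lt_min hp hq) hrt
  have hmt : m ≤ t := min_le_right _ _
  have hmp : m ≤ p := (min_le_left _ _).trans (min_le_left _ _)
  have hsub' : ∀ u ∈ Ico r m, u ∈ Icc s t := fun u hu => ⟨hsr.trans hu.1, hu.2.le.trans hmt⟩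
  have heq := ODE_solution_unique_of_mem_Icc_right (v := φ) (K := K) (a := r) (b := m) (f := x)
    (g := y) (s := fun _ => Metric.closedBall (x r) R)
    (fun u hu => hK u (hx.subset (Icc_subset_halfOpen hta (hsub' u hu))) _ le_rfl)
    (hcx.mono (Icc_subset_Icc hsr hmt))
    (fun u hu => hx.hasDerivWithinAt_Ici (Icc_subset_halfOpen hta (hsub' u hu)))
    (fun u hu => (hsub ⟨hu.1, hu.2.le.trans hmp⟩).1)
    (hcy.mono (Icc_subset_Icc hsr hmt))
    (fun u hu => hy.hasDerivWithinAt_Ici (Icc_subset_halfOpen htb (hsub' u hu)))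
    (fun u hu => (hsub ⟨hu.1, hu.2.le.trans hmp⟩).2) hr
  exact ⟨m, heq (right_mem_Icc.2 hm.le), hm, (min_le_left _ _).trans (min_le_right _ _)⟩

/-- Local existence of a solution that stays in a given open set. -/
theorem exists_isSolution [CompleteSpace X] (hφ : IsRegularField T D φ)
    (hU : IsOpen U) (hUD : U ⊆ D) (hs : s ∈ halfOpen 0 T) (hx₀ : x₀ ∈ U) :
    ∃ b : ℝ, ∃ x : ℝ → X, IsSolution T D φ s b x₀ x ∧ ∀ t ∈ halfOpen s b, x t ∈ U := by
  obtain ⟨R, hR, hRD, K, hK⟩ := exists_lipschitzOnWith_closedBall hφ (hUD hx₀)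
  have hnear : ∀ᶠ p in 𝓝[halfOpen 0 T] s ×ˢ 𝓝[D] x₀, ‖φ p.1 p.2‖ ≤ ‖φ s x₀‖ + 1 := by
    have := (hφ.continuousOn (s, x₀) ⟨hs, hUD hx₀⟩).norm.eventually_le_const (lt_add_one ‖φ s x₀‖)
    rwa [nhdsWithin_prod_eq] at this
  rw [hφ.isOpen.nhdsWithin_eq (hUD hx₀)] at hnear
  obtain ⟨P, hP, Q, hQ, hPQ⟩ := eventually_prod_iff.1 hnear
  have hP' : ∀ᶠ t in 𝓝[≥] s, P t ∧ t ∈ halfOpen 0 T := by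
    have h : 𝓝[≥] s ≤ 𝓝[halfOpen 0 T] s := nhdsWithin_le_iff.2 (halfOpen_mem_nhdsGE hs)
    exact (hP.filter_mono h).and (halfOpen_mem_nhdsGE hs)
  obtain ⟨p, hp, hpP⟩ := mem_nhdsGE_iff_exists_Icc_subset.1 hP'
  have hp : s < p := hp
  obtain ⟨R₁, hR₁, hR₁Q⟩ := Metric.nhds_basis_closedBall.mem_iff.1 hQ
  set r := min R R₁
  have hr : 0 < r := lt_min hR hR₁
  set L := ‖φ s x₀‖ + 1
  have hL : 0 < L := by positivity
  -- At speed at most L, a curve cannot leave the ball of radius r before time r / L.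
  set m := min p (s + r / L)
  have hm : s < m := lt_min hp (lt_add_of_pos_right s (div_pos hr hL))
  have hmp : ∀ t ∈ Icc s m, P t ∧ t ∈ halfOpen 0 T := fun t ht =>
    hpP ⟨ht.1, ht.2.trans (min_le_left _ _)⟩
  have hrD : Metric.closedBall x₀ r ⊆ D :=
    (Metric.closedBall_subset_closedBall (min_le_left _ _)).trans hRD
  have hpl : IsPicardLindelof φ (⟨s, left_mem_Icc.2 hm.le⟩ : Icc s m) x₀ ⟨r, hr.le⟩ 0 ⟨L, hL.le⟩
      K :=
    { lipschitzOnWith := fun t ht => hK t (hmp t ht).2 _ (min_le_left _ _)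
      continuousOn := fun x hx => hφ.continuousOn.comp (f := fun t : ℝ => (t, x)) (by fun_prop)
        fun t ht => ⟨(hmp t ht).2, hrD hx⟩
      norm_le := fun t ht x hx => hPQ (hmp t ht).1
        (hR₁Q (Metric.closedBall_subset_closedBall (min_le_right _ _) hx))
      mul_max_le := by
        have h : m - s ≤ r / L := by linarith [min_le_right p (s + r / L)]
        have : L * (m - s) ≤ r := by
          rw [le_div_iff₀ hL] at h
          linarith
        simpa [max_eq_left (sub_nonneg.2 hm.le)] using! this }
  obtain ⟨x, hxs, hx⟩ := hpl.exists_eq_forall_mem_Icc_hasDerivWithinAt₀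
  have hxs : x s = x₀ := hxs
  have hcs : ContinuousWithinAt x (Ici s) s :=
    ((hx s (left_mem_Icc.2 hm.le)).continuousWithinAt).mono_of_mem_nhdsWithin
      (Icc_mem_nhdsGE hm)
  obtain ⟨q, hq, hqU⟩ := mem_nhdsGE_iff_exists_Icc_subset.1
    (hcs (hU.mem_nhds (hxs ▸ hx₀)))
  have hq : s < q := hq
  have hmem : ∀ t ∈ halfOpen s (min m q : ℝ), x t ∈ U := fun t ht =>
    hqU ⟨ht.1, (EReal.coe_lt_coe_iff.1 ht.2).le.trans (min_le_right _ _)⟩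
  have hsub : halfOpen s (min m q : ℝ) ⊆ Icc s m := fun t ht =>
    ⟨ht.1, (EReal.coe_lt_coe_iff.1 ht.2).le.trans (min_le_left _ _)⟩
  exact ⟨min m q, x, ⟨EReal.coe_lt_coe_iff.2 (lt_min hm hq), fun t ht => (hmp t (hsub ht)).2, hxs,
    fun t ht => hUD (hmem t ht), fun t ht => (hx t (hsub ht)).mono hsub⟩, hmem⟩

theorem IsSolution.flow_eq (hφ : IsRegularField T D φ)
    (hx : IsSolution T D φ s a x₀ x) (ht : t ∈ halfOpen s a) : flow T D φ s t x₀ = x t := by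
  have h : ∃ x : ℝ → X, ∃ a : EReal, (t : EReal) < a ∧ IsSolution T D φ s a x₀ x :=
    ⟨x, a, ht.2, hx⟩
  obtain ⟨c, htc, hc⟩ := h.choose_spec
  rw [flow, dif_pos h]
  exact hc.eqOn hφ hx ht.1 htc ht.2

theorem IsSolution.lt_exitTime (hφ : IsRegularField T D φ)
    (hx : IsSolution T D φ s a x₀ x) (hxU : ∀ t ∈ halfOpen s a, x t ∈ U)
    (ht : t ∈ halfOpen s a) : (t : EReal) < exitTime T D φ U s x₀ := by
  -- The exit time only admits b strictly below the lifetime, and a may equal the lifetime.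
  obtain ⟨b, htb, hba⟩ := exists_between ht.2
  refine htb.trans_le (le_sSup ⟨(EReal.coe_le_coe_iff.2 ht.1).trans_lt htb,
    hba.trans_le (le_sSup ⟨x, hx⟩), fun r hr => ?_⟩)
  have hr' := halfOpen_mono le_rfl hba.le hr
  rw [hx.flow_eq hφ hr']
  exact hxU r hr'

theorem exists_isSolution_of_lt_exitTime (hφ : IsRegularField T D φ)
    (h : (t : EReal) < exitTime T D φ U s x₀) :
    ∃ b : EReal, ∃ x : ℝ → X, (t : EReal) < b ∧ IsSolution T D φ s b x₀ x ∧
      ∀ r ∈ halfOpen s b, x r ∈ U := by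
  obtain ⟨b, ⟨hsb, hb, hbU⟩, htb⟩ := lt_sSup_iff.1 h
  obtain ⟨a, ⟨x, hx⟩, hba⟩ := lt_sSup_iff.1 hb
  refine ⟨b, x, htb, hx.init ▸ hx.restrict le_rfl hsb hba.le, fun r hr => ?_⟩
  rw [← hx.flow_eq hφ (halfOpen_mono le_rfl hba.le hr)]
  exact hbU r hr

end Flow

/-! ### Comparison, and sufficiency of the infinitesimal condition. -/

section Contraction

variable {X : Type*} [NormedAddCommGroup X] [NormedSpace ℝ X] {C : ProperCone ℝ X}
  {T : EReal} {D U : Set X} {φ : ℝ → X → X}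

/-- A curve in `U` that grows strictly slower than the field stays below a solution. -/
theorem coneLE_of_strict_subsolution [CompleteSpace X] (hφ : IsRegularField T D φ) (hU : IsOpen U)
    (hUD : U ⊆ D) (hmono : OrderPreservingOn C T D φ U) {s t : ℝ} {a : EReal} {x₀ : X}
    {w y y' : ℝ → X} (hw : IsSolution T D φ s a x₀ w) (hwU : ∀ r ∈ halfOpen s a, w r ∈ U)
    (hst : s ≤ t) (hta : (t : EReal) < a) (hyU : ∀ r ∈ Icc s t, y r ∈ U)
    (hyc : ContinuousOn y (Icc s t)) (hy : ∀ r ∈ Ico s t, HasDerivWithinAt y (y' r) (Ici r) r)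
    (hy' : ∀ r ∈ Ico s t, φ r (y r) - y' r ∈ interior (C : Set X)) (hs : ConeLE C (y s) (w s)) :
    ConeLE C (y t) (w t) := by
  have hcl : IsClosed ({r | ConeLE C (y r) (w r)} ∩ Icc s t) := by
    rw [inter_comm]
    exact ((hw.continuousOn_Icc le_rfl hta).sub hyc).preimage_isClosed_of_isClosed isClosed_Icc
      C.isClosed
  refine hcl.Icc_subset_of_forall_exists_gt hs ?_ (right_mem_Icc.2 hst)
  rintro r ⟨hr, hsr, hrt⟩ q (hq : r < q)
  have hr : ConeLE C (y r) (w r) := hr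
  have hra : r ∈ halfOpen s a := Icc_subset_halfOpen hta ⟨hsr, hrt.le⟩
  have hyr := hyU r ⟨hsr, hrt.le⟩
  -- The solution v restarted from y r is squeezed in: y ≤ v just after r because v - y has its
  -- right derivative in the open set `interior C`, and v ≤ w by order preservation.
  obtain ⟨b, v, hv, hvU⟩ := exists_isSolution hφ hU hUD (hw.subset hra) hyr
  have hwr := hw.restrict hsr hra.2 le_rfl
  have hrb := EReal.coe_lt_coe_iff.1 hv.lt
  have hd : HasDerivWithinAt (fun p => v p - y p) (φ r (y r) - y' r) (Ioi r) r := by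
    have := hv.hasDerivWithinAt_Ici (left_mem_halfOpen hv.lt)
    rw [hv.init] at this
    exact (this.sub (hy r ⟨hsr, hrt⟩)).mono Ioi_subset_Ici_self
  have hev := ((hasDerivWithinAt_iff_tendsto_slope' self_notMem_Ioi).1 hd).eventually
    (mem_interior_iff_mem_nhds.1 (hy' r ⟨hsr, hrt⟩))
  have hb' : ∀ᶠ p in 𝓝[>] r, p ∈ Ioo r (min (min q t) b) :=
    Ioo_mem_nhdsGT (lt_min (lt_min hq hrt) hrb)
  obtain ⟨p, hp, hrp, hpm⟩ := (hev.and hb').exists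
  have hpb : p < b := hpm.trans_le (min_le_right _ _)
  have hpt : p < t := hpm.trans_le ((min_le_left _ _).trans (min_le_right _ _))
  have hpq : p < q := hpm.trans_le ((min_le_left _ _).trans (min_le_left _ _))
  refine ⟨p, ?_, hrp, hpq.le⟩
  have hyv : ConeLE C (y p) (v p) := by
    have := C.smul_mem hp (sub_nonneg.2 hrp.le)
    rw [sub_smul_slope] at this
    simpa [ConeLE, hv.init] using this
  have hpv : p ∈ halfOpen r (b : EReal) := ⟨hrp.le, EReal.coe_lt_coe_iff.2 hpb⟩
  have hpw : p ∈ halfOpen r a := ⟨hrp.le, (EReal.coe_lt_coe_iff.2 hpt).trans hta⟩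
  have hwrU : ∀ u ∈ halfOpen r a, w u ∈ U := fun u hu => hwU u (halfOpen_mono hsr le_rfl hu)
  have hvw := hmono (w r) (hwU r hra) (y r) hyr hr r (hw.subset hra) p hrp.le
    (lt_min (hwr.lt_exitTime hφ hwrU hpw) (hv.lt_exitTime hφ hvU hpv))
  rw [hv.flow_eq hφ hpv, hwr.flow_eq hφ hpw] at hvw
  exact hyv.trans hvw

/-- The function `r ↦ e^r f(e^{-r} x)`, whose growth measures how far `f` is from homogeneous. -/
theorem hasDerivAt_exp_smul_comp {f : X → X} {x : X} {r : ℝ}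
    (hf : DifferentiableAt ℝ f (Real.exp (-r) • x)) :
    HasDerivAt (fun r : ℝ => Real.exp r • f (Real.exp (-r) • x))
      (Real.exp r • (f (Real.exp (-r) • x) -
        fderiv ℝ f (Real.exp (-r) • x) (Real.exp (-r) • x))) r := by
  have h₁ : HasDerivAt (fun r : ℝ => Real.exp (-r) • x) (-(Real.exp (-r) • x)) r := by
    have := ((hasDerivAt_id r).neg.exp).smul_const x
    simpa using this
  have h₂ := (Real.hasDerivAt_exp r).smul (hf.hasFDerivAt.comp_hasDerivAt r h₁)
  refine h₂.congr_deriv ?_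
  simp only [map_neg, Function.comp_apply, smul_neg, smul_sub]
  abel

/-- The infinitesimal condition, integrated along a ray. -/
theorem coneLE_exp_smul_of_fderiv {f : X → X} {x : X} {α r : ℝ} (hr : 0 ≤ r)
    (hf : ∀ u ∈ Icc 0 r, DifferentiableAt ℝ f (Real.exp (-u) • x))
    (h : ∀ u ∈ Icc 0 r, ConeLE C (fderiv ℝ f (Real.exp (-u) • x) (Real.exp (-u) • x) -
      f (Real.exp (-u) • x)) (-α • Real.exp (-u) • x)) :
    ConeLE C (f x) (Real.exp r • f (Real.exp (-r) • x) - (α * r) • x) := by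
  have key := coneLE_of_hasDerivAt_mem (C := C)
    (f := fun u : ℝ => Real.exp u • f (Real.exp (-u) • x) - (α * u) • x) hr
    (fun u hu => (hasDerivAt_exp_smul_comp (hf u hu)).sub
      (((hasDerivAt_id u).const_mul α).smul_const x)) fun u hu => by
    have := C.smul_mem (h u hu) (Real.exp_pos u).le
    convert this using 1
    have he : Real.exp u * Real.exp (-u) = 1 := by rw [← Real.exp_add]; simp
    simp only [smul_sub, smul_smul, mul_one]
    rw [show Real.exp u * (-α * Real.exp (-u)) = -α by linear_combination -α * he, neg_smul]
    abel
  simpa using key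

/-- The contraction estimate, one-sided and along solutions. -/
theorem coneLE_exp_smul_solution [CompleteSpace X] (hφ : IsRegularField T D φ) (hU : IsOpen U)
    (hUD : U ⊆ D) (hUC : U ⊆ interior (C : Set X))
    (hUscale : ∀ l : ℝ, 0 < l → l ≤ 1 → ∀ x ∈ U, l • x ∈ U)
    (hmono : OrderPreservingOn C T D φ U) {α : ℝ}
    (hα : ∀ s ∈ halfOpen 0 T, ∀ x ∈ U, ConeLE C (fderiv ℝ (φ s) x x - φ s x) (-α • x))
    {s t : ℝ} {a b : EReal} {x₁ x₂ : X} {z w : ℝ → X} (hz : IsSolution T D φ s a x₁ z)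
    (hzU : ∀ r ∈ halfOpen s a, z r ∈ U) (hw : IsSolution T D φ s b x₂ w)
    (hwU : ∀ r ∈ halfOpen s b, w r ∈ U) (hst : s ≤ t) (hta : (t : EReal) < a)
    (htb : (t : EReal) < b) {d : ℝ} (hd : 0 ≤ d) (h : ConeLE C x₁ (Real.exp d • x₂)) :
    ConeLE C (z t) (Real.exp (Real.exp (-α * (t - s)) * d) • w t) := by
  have hscale : ∀ u : ℝ, 0 ≤ u → ∀ x ∈ U, Real.exp (-u) • x ∈ U := fun u hu x hx =>
    hUscale _ (Real.exp_pos _) (Real.exp_le_one_iff.2 (by linarith)) x hx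
  have hinv : ∀ u : ℝ, Real.exp u * Real.exp (-u) = 1 := fun u => by rw [← Real.exp_add]; simp
  have hx₁ : x₁ ∈ U := hz.init ▸ hzU s (left_mem_halfOpen hz.lt)
  have hx₂ : x₂ ∈ U := hw.init ▸ hwU s (left_mem_halfOpen hw.lt)
  have strict : ∀ ε : ℝ, 0 < ε →
      ConeLE C (z t) (Real.exp (Real.exp (-(α - ε) * (t - s)) * (d + ε)) • w t) := by
    intro ε hε
    -- The ε in the rate makes the subsolution strict, with gain e^{-ρ}ερz in the interior; the ε
    -- added to d keeps ρ positive even when d = 0.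
    set ρ : ℝ → ℝ := fun r => Real.exp (-(α - ε) * (r - s)) * (d + ε) with hρ
    have hρpos : ∀ r, 0 < ρ r := fun r => mul_pos (Real.exp_pos _) (by linarith)
    have hρd : ∀ r, HasDerivAt ρ (-(α - ε) * ρ r) r := fun r => by
      have := ((((hasDerivAt_id r).sub_const s).const_mul (-(α - ε))).exp).mul_const (d + ε)
      refine this.congr_deriv ?_
      simp only [hρ, id]
      ring
    have hlam : ∀ r, HasDerivAt (fun r => Real.exp (-ρ r))
        (Real.exp (-ρ r) * ((α - ε) * ρ r)) r := fun r =>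
      ((hρd r).neg.exp).congr_deriv (by simp only [Pi.neg_apply]; ring)
    have hle : ConeLE C (Real.exp (-ρ t) • z t) (w t) := by
      refine coneLE_of_strict_subsolution hφ hU hUD hmono hw hwU hst htb
        (y := fun r => Real.exp (-ρ r) • z r)
        (y' := fun r => Real.exp (-ρ r) • φ r (z r) + (Real.exp (-ρ r) * ((α - ε) * ρ r)) • z r)
        (fun r hr => hscale _ (hρpos r).le _ (hzU r (Icc_subset_halfOpen hta hr)))
        (ContinuousOn.smul (fun r _ => (hlam r).continuousAt.continuousWithinAt)
          (hz.continuousOn_Icc le_rfl hta))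
        (fun r hr => (hlam r).hasDerivWithinAt.smul (hz.hasDerivWithinAt_Ici
          (Icc_subset_halfOpen hta (Ico_subset_Icc_self hr)))) (fun r hr => ?_) ?_
      · have hra := Icc_subset_halfOpen hta (Ico_subset_Icc_self hr)
        have hr0 := hz.subset hra
        have hzr := hzU r hra
        have h₁ := (coneLE_exp_smul_of_fderiv (C := C) (f := φ r) (x := z r) (α := α)
          (hρpos r).le
          (fun u hu => hφ.differentiableAt r hr0 _ (hUD (hscale u hu.1 _ hzr)))
          (fun u hu => hα r hr0 _ (hscale u hu.1 _ hzr))).smul (Real.exp_pos (-ρ r)).le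
        have h₂ := smul_mem_interior (hUC hzr)
          (mul_pos (Real.exp_pos (-ρ r)) (mul_pos hε (hρpos r)))
        have h₃ := add_mem_interior h₁ h₂
        convert h₃ using 1
        rw [smul_sub, smul_smul, smul_smul, mul_comm (Real.exp (-ρ r)) (Real.exp (ρ r)), hinv]
        module
      · have hρs : ρ s = d + ε := by simp [hρ]
        simp only [hρs, hz.init, hw.init]
        have h₁ := h.smul (Real.exp_pos (-(d + ε))).le
        rw [smul_smul, ← Real.exp_add] at h₁
        refine h₁.trans ?_
        have hnn : 0 ≤ 1 - Real.exp (-(d + ε) + d) :=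
          sub_nonneg.2 (Real.exp_le_one_iff.2 (by linarith))
        have := C.smul_mem (interior_subset (hUC hx₂)) hnn
        rwa [sub_smul, one_smul] at this
    have := hle.smul (Real.exp_pos (ρ t)).le
    rwa [smul_smul, hinv, one_smul] at this
  -- C is closed, so the inequality survives ε → 0.
  have hlim : Tendsto (fun ε : ℝ =>
      Real.exp (Real.exp (-(α - ε) * (t - s)) * (d + ε)) • w t - z t) (𝓝[>] 0)
      (𝓝 (Real.exp (Real.exp (-α * (t - s)) * d) • w t - z t)) := by
    have : Continuous fun ε : ℝ =>
      Real.exp (Real.exp (-(α - ε) * (t - s)) * (d + ε)) • w t - z t := by fun_prop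
    simpa using (this.tendsto 0).mono_left nhdsWithin_le_nhds
  exact C.isClosed.mem_of_tendsto hlim
    (eventually_of_mem self_mem_nhdsWithin fun ε hε => strict ε hε)

theorem contractsOn_of_forall_coneLE [CompleteSpace X] [Nontrivial X]
    (hC : ∀ x : X, x ∈ C → -x ∈ C → x = 0) (hφ : IsRegularField T D φ) (hU : IsOpen U)
    (hUD : U ⊆ D) (hUC : U ⊆ interior (C : Set X))
    (hUscale : ∀ l : ℝ, 0 < l → l ≤ 1 → ∀ x ∈ U, l • x ∈ U)
    (hmono : OrderPreservingOn C T D φ U) {α : ℝ}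
    (hα : ∀ s ∈ halfOpen 0 T, ∀ x ∈ U, ConeLE C (fderiv ℝ (φ s) x x - φ s x) (-α • x)) :
    ContractsOn C T D φ U α := by
  intro x₁ hx₁ x₂ hx₂ s _ t hst ht
  obtain ⟨ht₁, ht₂⟩ := lt_min_iff.1 ht
  obtain ⟨a, z, hta, hz, hzU⟩ := exists_isSolution_of_lt_exitTime hφ ht₁
  obtain ⟨b, w, htb, hw, hwU⟩ := exists_isSolution_of_lt_exitTime hφ ht₂
  rw [hz.flow_eq hφ ⟨hst, hta⟩, hw.flow_eq hφ ⟨hst, htb⟩,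
    thompsonDist_le_iff hC (hUC (hzU t ⟨hst, hta⟩)) (hUC (hwU t ⟨hst, htb⟩))]
  have hd := thompsonDist_nonneg hC (hUC hx₁) (hUC hx₂)
  obtain ⟨h₁, h₂⟩ := (thompsonDist_le_iff hC (hUC hx₁) (hUC hx₂)).1 le_rfl
  exact ⟨coneLE_exp_smul_solution hφ hU hUD hUC hUscale hmono hα hz hzU hw hwU hst hta htb hd h₁,
    coneLE_exp_smul_solution hφ hU hUD hUC hUscale hmono hα hw hwU hz hzU hst htb hta hd h₂⟩

/-! ### Necessity of the infinitesimal condition, and the best constant. -/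

/-- A right derivative of a curve that starts at `0` and stays in the cone is in the cone. -/
theorem mem_of_hasDerivWithinAt_of_eventually_mem {f : ℝ → X} {f' : X} {s : ℝ}
    (hf : HasDerivWithinAt f f' (Ici s) s) (h0 : f s = 0) (h : ∀ᶠ t in 𝓝[>] s, f t ∈ C) :
    f' ∈ C := by
  have hlim := (hasDerivWithinAt_iff_tendsto_slope' self_notMem_Ioi).1 (hf.mono Ioi_subset_Ici_self)
  refine C.isClosed.mem_of_tendsto hlim ?_
  filter_upwards [h, self_mem_nhdsWithin] with t ht hst
  have hst : s < t := hst
  rw [slope_def_module, h0, sub_zero]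
  exact C.smul_mem ht (inv_nonneg.2 (sub_nonneg.2 hst.le))

/-- The curve e^{e^{-α(t-s)}r} w(t) - z(t), with z from x and w from e^{-r}x, vanishes at t = s and
stays in C, so its right derivative at s is in C. -/
theorem ContractsOn.coneLE_exp_smul [CompleteSpace X] [Nontrivial X]
    (hC : ∀ x : X, x ∈ C → -x ∈ C → x = 0) (hφ : IsRegularField T D φ) (hU : IsOpen U)
    (hUD : U ⊆ D) (hUC : U ⊆ interior (C : Set X))
    (hUscale : ∀ l : ℝ, 0 < l → l ≤ 1 → ∀ x ∈ U, l • x ∈ U) {α : ℝ}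
    (h : ContractsOn C T D φ U α) {s : ℝ} (hs : s ∈ halfOpen 0 T) {x : X} (hx : x ∈ U) {r : ℝ}
    (hr : 0 ≤ r) :
    ConeLE C (φ s x) (Real.exp r • φ s (Real.exp (-r) • x) - (α * r) • x) := by
  have hinv : Real.exp r * Real.exp (-r) = 1 := by rw [← Real.exp_add]; simp
  have hx₂ : Real.exp (-r) • x ∈ U :=
    hUscale _ (Real.exp_pos _) (Real.exp_le_one_iff.2 (by linarith)) x hx
  obtain ⟨a, z, hz, hzU⟩ := exists_isSolution hφ hU hUD hs hx
  obtain ⟨b, w, hw, hwU⟩ := exists_isSolution hφ hU hUD hs hx₂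
  have hdist : thompsonDist C x (Real.exp (-r) • x) ≤ r := by
    rw [thompsonDist_le_iff hC (hUC hx) (hUC hx₂)]
    constructor
    · rw [smul_smul, hinv, one_smul, ConeLE, sub_self]
      exact C.zero_mem
    · have hnn : 0 ≤ Real.exp r - Real.exp (-r) := sub_nonneg.2 (Real.exp_le_exp.2 (by linarith))
      have := C.smul_mem (interior_subset (hUC hx)) hnn
      rwa [sub_smul] at this
  have hev : ∀ᶠ t in 𝓝[>] s, Real.exp (Real.exp (-α * (t - s)) * r) • w t - z t ∈ C := by
    filter_upwards [Ioo_mem_nhdsGT (lt_min (EReal.coe_lt_coe_iff.1 hz.lt)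
      (EReal.coe_lt_coe_iff.1 hw.lt))] with t ht
    have hta : t ∈ halfOpen s (a : EReal) :=
      ⟨ht.1.le, EReal.coe_lt_coe_iff.2 (ht.2.trans_le (min_le_left _ _))⟩
    have htb : t ∈ halfOpen s (b : EReal) :=
      ⟨ht.1.le, EReal.coe_lt_coe_iff.2 (ht.2.trans_le (min_le_right _ _))⟩
    have := h x hx _ hx₂ s hs t ht.1.le
      (lt_min (hz.lt_exitTime hφ hzU hta) (hw.lt_exitTime hφ hwU htb))
    rw [hz.flow_eq hφ hta, hw.flow_eq hφ htb] at this
    exact ((thompsonDist_le_iff hC (hUC (hzU t hta)) (hUC (hwU t htb))).1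
      (this.trans (mul_le_mul_of_nonneg_left hdist (Real.exp_pos _).le))).1
  have hc : HasDerivAt (fun t => Real.exp (Real.exp (-α * (t - s)) * r))
      (Real.exp r * (-α * r)) s := by
    have := (((((hasDerivAt_id s).sub_const s).const_mul (-α)).exp).mul_const r).exp
    simpa using this
  have hd := (hc.hasDerivWithinAt.smul (hw.hasDerivWithinAt_Ici (left_mem_halfOpen hw.lt))).sub
    (hz.hasDerivWithinAt_Ici (left_mem_halfOpen hz.lt))
  have := mem_of_hasDerivWithinAt_of_eventually_mem hd
    (by simp [hw.init, hz.init, smul_smul, hinv]) hev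
  unfold ConeLE
  convert this using 1
  simp only [hw.init, hz.init, sub_self, mul_zero, Real.exp_zero, one_mul, smul_smul]
  rw [show Real.exp r * (-α * r) * Real.exp (-r) = -(α * r) by
    linear_combination (-α * r) * hinv]
  module

/-- Both sides of `ContractsOn.coneLE_exp_smul` agree at r = 0, so the right derivative in r of
their difference lies in C. -/
theorem ContractsOn.coneLE_fderiv [CompleteSpace X] [Nontrivial X]
    (hC : ∀ x : X, x ∈ C → -x ∈ C → x = 0) (hφ : IsRegularField T D φ) (hU : IsOpen U)
    (hUD : U ⊆ D) (hUC : U ⊆ interior (C : Set X))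
    (hUscale : ∀ l : ℝ, 0 < l → l ≤ 1 → ∀ x ∈ U, l • x ∈ U) {α : ℝ}
    (h : ContractsOn C T D φ U α) {s : ℝ} (hs : s ∈ halfOpen 0 T) {x : X} (hx : x ∈ U) :
    ConeLE C (fderiv ℝ (φ s) x x - φ s x) (-α • x) := by
  have hx' : DifferentiableAt ℝ (φ s) (Real.exp (-0) • x) := by
    simpa using hφ.differentiableAt s hs x (hUD hx)
  have hd := ((hasDerivAt_exp_smul_comp hx').sub
    (((hasDerivAt_id (0 : ℝ)).const_mul α).smul_const x)).sub_const (φ s x)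
  have := mem_of_hasDerivWithinAt_of_eventually_mem (C := C) hd.hasDerivWithinAt (by simp)
    (eventually_of_mem self_mem_nhdsWithin fun r (hr : 0 < r) => by
      simpa [ConeLE] using h.coneLE_exp_smul hC hφ hU hUD hUC hUscale hs hx hr.le)
  unfold ConeLE
  convert this using 1
  simp only [neg_zero, Real.exp_zero, one_smul, mul_one]
  module

theorem isBestConstant_of_iff {P : ℝ → Prop} {a : EReal} (h : ∀ α : ℝ, P α ↔ (α : EReal) ≤ a) :
    IsBestConstant P a := by
  refine ⟨⟨?_, fun b hb => ?_⟩, fun r hr => (h r).2 hr.le⟩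
  · rintro _ ⟨α, hα, rfl⟩
    exact (h α).1 hα
  · by_contra! hlt
    obtain ⟨r, hbr, hra⟩ := EReal.lt_iff_exists_real_btwn.1 hlt
    exact (hb ⟨r, (h r).2 hra.le, rfl⟩).not_gt hbr

end Contraction

end ThompsonFlow

open ThompsonFlow

theorem mainTheorem1 {X : Type*} [NormedAddCommGroup X] [NormedSpace ℝ X] [CompleteSpace X]
    [Nontrivial X]
    (C : ProperCone ℝ X) (hC : ∀ x : X, x ∈ C → -x ∈ C → x = 0)
    (T : EReal) (D : Set X) (hD : IsOpen D) (φ : ℝ → X → X)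
    (hcont : ContinuousOn (fun p : ℝ × X => φ p.1 p.2) (ThompsonFlow.halfOpen 0 T ×ˢ D))
    (hdiff : ∀ t ∈ ThompsonFlow.halfOpen 0 T, ∀ x ∈ D, DifferentiableAt ℝ (φ t) x)
    (hbound : ∀ K : Set X, K ⊆ D → IsClosed K → Bornology.IsBounded K →
      ∃ L : ℝ, ∀ t ∈ ThompsonFlow.halfOpen 0 T, ∀ x ∈ K, ‖fderiv ℝ (φ t) x‖ ≤ L)
    (U : Set X) (hU : IsOpen U) (hUD : U ⊆ D) (hUC : U ⊆ interior (C : Set X))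
    (hUscale : ∀ l : ℝ, 0 < l → l ≤ 1 → ∀ x ∈ U, l • x ∈ U)
    (hmono : ThompsonFlow.OrderPreservingOn C T D φ U) :
    ThompsonFlow.IsBestConstant (ThompsonFlow.ContractsOn C T D φ U)
      (-(⨆ s ∈ ThompsonFlow.halfOpen 0 T, ⨆ x ∈ U,
        ((ThompsonFlow.coneM C (fderiv ℝ (φ s) x x - φ s x) x : ℝ) : EReal))) := by
  have hφ : IsRegularField T D φ := ⟨hD, hcont, hdiff, hbound⟩
  refine isBestConstant_of_iff fun α => ?_
  -- An empty supremum is ⊥, so its negative is ⊤ and every α qualifies, as it should.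
  rw [EReal.le_neg, iSup₂_le_iff]
  simp only [iSup₂_le_iff]
  have key : ∀ s, ∀ x ∈ U, ((coneM C (fderiv ℝ (φ s) x x - φ s x) x : ℝ) : EReal) ≤ -(α : EReal) ↔
      ConeLE C (fderiv ℝ (φ s) x x - φ s x) (-α • x) := fun s x hx => by
    rw [← EReal.coe_neg, EReal.coe_le_coe_iff, coneM_le_iff hC (hUC hx)]
  refine ⟨fun h s hs x hx => (key s x hx).2 (h.coneLE_fderiv hC hφ hU hUD hUC hUscale hs hx),
    fun h => contractsOn_of_forall_coneLE hC hφ hU hUD hUC hUscale hmono fun s hs x hx =>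
      (key s x hx).1 (h s hs x hx)⟩
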